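/- Let $n\ge 0$ be an integer, let $T>0$, and let $V:\mathbb R^n\to\mathbb R$ satisfy (V1) $V$ is locally Lipschitz; (V2) there are constants $\mu_1>2$ and $\mu_2\in\mathbb R$ such that $\langle y,x\rangle\ge\mu_1V(x)+\mu_2$ for all $x\in\mathbb R^n$ and all $y\in\partial V(x)$; (V3) there are constants $a_1>0$ and $a_2\in\mathbb R$ such that $V(x)\ge a_1|x|^{\mu_1}+a_2$ for all $x\in\mathbb R^n$. Here, for a locally Lipschitz function $f$ on a real Banach space $X$, $\partial f(x)$ is Clarke's generalized gradient $$\partial f(x)=\{x^*\in X^*:\ \langle x^*,v\rangle\le f^0(x,v)\ \ \forall v\in X\},\qquad f^0(x,v)=\limsup_{y\to x,\ \lambda\downarrow0}\frac{f(y+\lambda v)-f(y)}{\lambda}.$$ Let $H^1=W^{1,2}(\mathbb R/T\mathbb Z,\mathbb R^n)$ with the norm $\|q\|=\left(\int_0^T|\dot q|^2\,dt\right)^{1/2}+|q(0)|$, where $q(0)$ is the value at $0$ of the continuous representative of $q$, and let $$f(q)=\frac12\int_0^T|\dot q|^2\,dt-\int_0^TV(q)\,dt,\qquad q\in H^1 .$$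 Then $f$ satisfies the Cerami–Palais–Smale–Chang condition on $H^1$; that is, $f$ is locally Lipschitz on $H^1$ and, for every $c\in\mathbb R$, every sequence $(q_k)$ in $H^1$ with $$f(q_k)\to c\qquad\text{and}\qquad(1+\|q_k\|)\min_{x^*\in\partial f(q_k)}\|x^*\|\to0$$ has a subsequence that converges strongly (that is, in norm) in $H^1$. -/

import Mathlib

open MeasureTheory Filter Topology Set
open scoped ContDiff

namespace PeriodicSobolev

noncomputable section

variable {T : ℝ} [hT : Fact (0 < T)] {n : ℕ}

/-- The space `L²(ℝ/Tℤ, ℝⁿ)`, where `ℝ/Tℤ` carries its Lebesgue measure of total mass `T`. -/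
abbrev L2 (T : ℝ) [Fact (0 < T)] (n : ℕ) : Type :=
  Lp (EuclideanSpace ℝ (Fin n)) 2 (volume : Measure (AddCircle T))

/-- `g` is a weak derivative of `q`: `∫₀ᵀ φ' q dt = -∫₀ᵀ φ g dt` for every smooth `T`-periodic
test function `φ`. -/
def IsWeakDeriv (q g : L2 T n) : Prop :=
  ∀ φ : ℝ → ℝ, ContDiff ℝ ∞ φ → Function.Periodic φ T →
    ∫ t in (0 : ℝ)..T, deriv φ t • q (t : AddCircle T) =
      -∫ t in (0 : ℝ)..T, φ t • g (t : AddCircle T)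

lemma intervalIntegrable_of_memLp {F : Type*} [NormedAddCommGroup F] {h : AddCircle T → F}
    (hh : MemLp h 2 (volume : Measure (AddCircle T))) :
    IntervalIntegrable (fun t : ℝ => h (t : AddCircle T)) volume 0 T := by
  rw [intervalIntegrable_iff_integrableOn_Ioc_of_le hT.out.le]
  have := (AddCircle.measurePreserving_mk T 0).integrable_comp_of_integrable
    (hh.integrable (by norm_num))
  simpa [IntegrableOn, Function.comp_def] using this

lemma ae_coe {P : AddCircle T → Prop} (h : ∀ᵐ x : AddCircle T, P x) :
    ∀ᵐ t : ℝ, t ∈ uIoc 0 T → P (t : AddCircle T) := by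
  have := (AddCircle.measurePreserving_mk T 0).quasiMeasurePreserving.ae h
  rw [uIoc_of_le hT.out.le]
  rw [zero_add] at this
  exact (ae_restrict_iff' measurableSet_Ioc).1 this

lemma integral_coord {a b : ℝ} {h : ℝ → EuclideanSpace ℝ (Fin n)}
    (hh : IntervalIntegrable h volume a b) (i : Fin n) :
    (∫ t in a..b, h t) i = ∫ t in a..b, h t i :=
  ((EuclideanSpace.proj (𝕜 := ℝ) i).intervalIntegral_comp_comm hh).symm

lemma memLp_coord {h : AddCircle T → EuclideanSpace ℝ (Fin n)}
    (hh : MemLp h 2 (volume : Measure (AddCircle T))) (i : Fin n) :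
    MemLp (fun x => h x i) 2 (volume : Measure (AddCircle T)) :=
  (EuclideanSpace.proj (𝕜 := ℝ) i : _ →L[ℝ] ℝ).comp_memLp' hh

/-- Fundamental lemma: an `L²` function on the circle that is orthogonal to all smooth periodic
functions vanishes almost everywhere. -/
lemma ae_eq_zero_of_orth {h : AddCircle T → EuclideanSpace ℝ (Fin n)}
    (hh : MemLp h 2 (volume : Measure (AddCircle T)))
    (H : ∀ φ : ℝ → ℝ, ContDiff ℝ ∞ φ → Function.Periodic φ T →
      ∫ t in (0 : ℝ)..T, φ t • h (t : AddCircle T) = 0) :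
    ∀ᵐ x : AddCircle T, h x = 0 := by
  have key : ∀ i : Fin n, ∀ᵐ x : AddCircle T, h x i = 0 := by
    intro i
    have hi := memLp_coord hh i
    have hc : MemLp (fun x => (h x i : ℂ)) 2 (AddCircle.haarAddCircle (T := T)) :=
      memLp_haarAddCircle_iff.2 hi.ofReal
    have horth : ∀ φ : ℝ → ℝ, ContDiff ℝ ∞ φ → Function.Periodic φ T →
        ∫ t in (0 : ℝ)..T, φ t * h (t : AddCircle T) i = 0 := by
      intro φ h1 h2
      have h3 := congrArg (fun v => v i) (H φ h1 h2)
      simp only [PiLp.zero_apply] at h3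
      rw [integral_coord] at h3
      · simpa using h3
      · exact (intervalIntegrable_of_memLp hh).continuousOn_smul h1.continuous.continuousOn
    have hz : hc.toLp _ = 0 := by
      apply (fourierBasis (T := T)).repr.injective
      ext k
      rw [fourierBasis_repr, fourierCoeff_congr_ae hc.coeFn_toLp,
        fourierCoeff_eq_intervalIntegral _ _ 0, zero_add, map_zero]
      have hsm : ContDiff ℝ ∞ (fun t : ℝ => fourier (T := T) (-k) (t : AddCircle T)) := by
        simp only [fourier_coe_apply]
        have : ContDiff ℝ ∞ (fun t : ℝ => (t : ℂ)) := Complex.ofRealCLM.contDiff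
        fun_prop
      have hper : Function.Periodic (fun t : ℝ => fourier (T := T) (-k) (t : AddCircle T)) T := by
        intro t; simp
      have hre := horth (fun t => (fourier (T := T) (-k) (t : AddCircle T)).re)
        (Complex.reCLM.contDiff.comp hsm) (fun t => congrArg Complex.re (hper t))
      have him := horth (fun t => (fourier (T := T) (-k) (t : AddCircle T)).im)
        (Complex.imCLM.contDiff.comp hsm) (fun t => congrArg Complex.im (hper t))
      have hint := intervalIntegrable_of_memLp hi
      have hint2 : IntervalIntegrable (fun t : ℝ => fourier (T := T) (-k) (t : AddCircle T) •
          (h (t : AddCircle T) i : ℂ)) volume 0 T :=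
        (intervalIntegrable_of_memLp (F := ℂ) hi.ofReal).continuousOn_smul
          hsm.continuous.continuousOn
      have : ∫ t in (0 : ℝ)..T, fourier (T := T) (-k) (t : AddCircle T) •
          (h (t : AddCircle T) i : ℂ) = 0 := by
        apply Complex.ext
        · have := Complex.reCLM.intervalIntegral_comp_comm hint2
          simp only [Complex.reCLM_apply] at this
          rw [← this, Complex.zero_re]
          refine Eq.trans (intervalIntegral.integral_congr fun t _ => ?_) hre
          simp [Complex.mul_re]
        · have := Complex.imCLM.intervalIntegral_comp_comm hint2
          simp only [Complex.imCLM_apply] at this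
          rw [← this, Complex.zero_im]
          refine Eq.trans (intervalIntegral.integral_congr fun t _ => ?_) him
          simp [Complex.mul_im]
      rw [this]; simp
    have h0 : (fun x => (h x i : ℂ)) =ᵐ[AddCircle.haarAddCircle (T := T)] 0 := by
      have := hc.coeFn_toLp
      rw [hz] at this
      exact this.symm.trans (Lp.coeFn_zero _ _ _)
    rw [AddCircle.volume_eq_smul_haarAddCircle]
    refine Measure.ae_smul_measure ?_ _
    filter_upwards [h0] with x hx
    simpa using hx
  filter_upwards [ae_all_iff.2 key] with x hx
  ext i
  simpa using hx i

lemma IsWeakDeriv.unique {q g g' : L2 T n} (h : IsWeakDeriv q g) (h' : IsWeakDeriv q g') :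
    g = g' := by
  have key : ∀ᵐ x : AddCircle T, (g - g' : L2 T n) x = 0 := by
    refine ae_eq_zero_of_orth (Lp.memLp _) fun φ h1 h2 => ?_
    have e1 := (intervalIntegrable_of_memLp (Lp.memLp g)).continuousOn_smul
      h1.continuous.continuousOn
    have e2 := (intervalIntegrable_of_memLp (Lp.memLp g')).continuousOn_smul
      h1.continuous.continuousOn
    have e3 : ∫ t in (0 : ℝ)..T, φ t • (g - g' : L2 T n) (t : AddCircle T) =
        ∫ t in (0 : ℝ)..T, (φ t • g (t : AddCircle T) - φ t • g' (t : AddCircle T)) := by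
      apply intervalIntegral.integral_congr_ae
      filter_upwards [ae_coe (Lp.coeFn_sub g g')] with t ht ht'
      rw [ht ht', Pi.sub_apply, smul_sub]
    rw [e3, intervalIntegral.integral_sub e1 e2, sub_eq_zero]
    have := (h φ h1 h2).symm.trans (h' φ h1 h2)
    exact neg_injective this
  rw [← sub_eq_zero]
  apply Lp.ext
  filter_upwards [key, Lp.coeFn_zero (EuclideanSpace ℝ (Fin n)) 2
    (volume : Measure (AddCircle T))] with x h0 hx
  rw [h0, hx]; rfl

lemma IsWeakDeriv.add {q g q' g' : L2 T n} (h : IsWeakDeriv q g) (h' : IsWeakDeriv q' g') :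
    IsWeakDeriv (q + q') (g + g') := by
  have sp : ∀ (ψ : ℝ → ℝ) (_ : Continuous ψ) (u v : L2 T n),
      ∫ t in (0 : ℝ)..T, ψ t • (u + v : L2 T n) (t : AddCircle T) =
      (∫ t in (0 : ℝ)..T, ψ t • u (t : AddCircle T)) +
        ∫ t in (0 : ℝ)..T, ψ t • v (t : AddCircle T) := by
    intro ψ hψ u v
    rw [← intervalIntegral.integral_add
      ((intervalIntegrable_of_memLp (Lp.memLp u)).continuousOn_smul hψ.continuousOn)
      ((intervalIntegrable_of_memLp (Lp.memLp v)).continuousOn_smul hψ.continuousOn)]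
    apply intervalIntegral.integral_congr_ae
    filter_upwards [ae_coe (Lp.coeFn_add u v)] with t ht ht'
    rw [ht ht', Pi.add_apply, smul_add]
  intro φ h1 h2
  rw [sp _ (h1.continuous_deriv (by simp)), sp _ h1.continuous, h φ h1 h2, h' φ h1 h2, neg_add]

lemma IsWeakDeriv.smul {q g : L2 T n} (c : ℝ) (h : IsWeakDeriv q g) :
    IsWeakDeriv (c • q) (c • g) := by
  have sp : ∀ (ψ : ℝ → ℝ) (u : L2 T n),
      ∫ t in (0 : ℝ)..T, ψ t • (c • u : L2 T n) (t : AddCircle T) =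
      c • ∫ t in (0 : ℝ)..T, ψ t • u (t : AddCircle T) := by
    intro ψ u
    rw [← intervalIntegral.integral_smul]
    apply intervalIntegral.integral_congr_ae
    filter_upwards [ae_coe (Lp.coeFn_smul c u)] with t ht ht'
    rw [ht ht', Pi.smul_apply, smul_comm]
  intro φ h1 h2
  rw [sp, sp, h φ h1 h2, smul_neg]

lemma IsWeakDeriv.zero : IsWeakDeriv (0 : L2 T n) 0 := by
  intro φ _ _
  have sp : ∀ ψ : ℝ → ℝ, ∫ t in (0 : ℝ)..T, ψ t • (0 : L2 T n) (t : AddCircle T) = 0 := by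
    intro ψ
    apply intervalIntegral.integral_zero_ae
    filter_upwards [ae_coe (Lp.coeFn_zero (EuclideanSpace ℝ (Fin n)) 2
      (volume : Measure (AddCircle T)))] with t ht ht'
    rw [ht ht']; simp
  rw [sp, sp, neg_zero]

/-- An `L²` function with vanishing weak derivative is almost everywhere constant. -/
lemma ae_const_of_weakDeriv_zero {h : AddCircle T → EuclideanSpace ℝ (Fin n)}
    (hh : MemLp h 2 (volume : Measure (AddCircle T)))
    (H : ∀ φ : ℝ → ℝ, ContDiff ℝ ∞ φ → Function.Periodic φ T →
      ∫ t in (0 : ℝ)..T, deriv φ t • h (t : AddCircle T) = 0) :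
    ∃ c, ∀ᵐ x : AddCircle T, h x = c := by
  have hT0 : T ≠ 0 := hT.out.ne'
  have hi := intervalIntegrable_of_memLp hh
  set c : EuclideanSpace ℝ (Fin n) := T⁻¹ • ∫ t in (0 : ℝ)..T, h (t : AddCircle T) with hc
  refine ⟨c, ?_⟩
  have hcm : MemLp (fun _ : AddCircle T => c) 2 volume := memLp_const c
  have := ae_eq_zero_of_orth (hh.sub hcm) fun φ h1 h2 => by
    set m : ℝ := T⁻¹ * ∫ t in (0 : ℝ)..T, φ t with hm
    have hφi : ∀ a b : ℝ, IntervalIntegrable φ volume a b :=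
      fun a b => h1.continuous.intervalIntegrable a b
    set Φ : ℝ → ℝ := fun t => ∫ s in (0 : ℝ)..t, (φ s - m) with hΦ
    have hψ : Continuous fun s => φ s - m := h1.continuous.sub continuous_const
    have hd : ∀ t, HasDerivAt Φ (φ t - m) t := fun t =>
      hψ.integral_hasStrictDerivAt 0 t |>.hasDerivAt
    have hder : deriv Φ = fun t => φ t - m := funext fun t => (hd t).deriv
    have hsm : ContDiff ℝ ∞ Φ := by
      rw [contDiff_infty_iff_deriv, hder]
      exact ⟨fun t => (hd t).differentiableAt, h1.sub contDiff_const⟩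
    have hper : Function.Periodic Φ T := by
      intro t
      have hp : Function.Periodic (fun s => φ s - m) T := fun s => by simp [h2 s]
      have e1 := hp.intervalIntegral_add_eq t 0
      have e2 : ∫ s in (0 : ℝ)..T, (φ s - m) = 0 := by
        rw [intervalIntegral.integral_sub (hφi _ _) (by simp)]
        simp [hm, mul_left_comm T⁻¹ T, mul_inv_cancel_left₀ hT0]
      rw [zero_add, e2] at e1
      have := intervalIntegral.integral_add_adjacent_intervals
        (hψ.intervalIntegrable (μ := volume) 0 t) (hψ.intervalIntegrable (μ := volume) t (t + T))
      simp only [hΦ]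
      rw [← this, e1, add_zero]
    have e := H Φ hsm hper
    rw [hder] at e
    have i1 := hi.continuousOn_smul h1.continuous.continuousOn
    have i2 : IntervalIntegrable (fun t : ℝ => φ t • c) volume 0 T :=
      (h1.continuous.smul continuous_const).intervalIntegrable _ _
    have i3 : IntervalIntegrable (fun t : ℝ => m • h (t : AddCircle T)) volume 0 T := hi.smul m
    simp only [sub_smul] at e
    rw [intervalIntegral.integral_sub i1 i3, intervalIntegral.integral_smul] at e
    simp only [Pi.sub_apply, smul_sub]
    rw [intervalIntegral.integral_sub i1 i2, intervalIntegral.integral_smul_const, hc,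
      smul_smul, mul_comm _ T⁻¹]
    exact e
  filter_upwards [this] with x hx
  simpa [sub_eq_zero] using hx

/-- One-dimensional Sobolev embedding: a class in `L²` with a weak derivative in `L²` has a
continuous representative. -/
lemma exists_continuous_rep {q g : L2 T n} (h : IsWeakDeriv q g) :
    ∃ u : C(AddCircle T, EuclideanSpace ℝ (Fin n)), q =ᵐ[volume] u := by
  have hgi := intervalIntegrable_of_memLp (Lp.memLp g)
  have hgp : Function.Periodic (fun t : ℝ => g (t : AddCircle T)) T := fun t => by simp
  have hgi' : ∀ a b : ℝ, IntervalIntegrable (fun t : ℝ => g (t : AddCircle T)) volume a b :=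
    fun a b => hgp.intervalIntegrable₀ hT.out.ne' hgi a b
  have hmean : ∫ t in (0 : ℝ)..T, g (t : AddCircle T) = 0 := by
    have := h (fun _ => 1) contDiff_const (fun _ => rfl)
    simpa using this.symm
  set G : ℝ → EuclideanSpace ℝ (Fin n) := fun t => ∫ s in (0 : ℝ)..t, g (s : AddCircle T) with hG
  have hGc : Continuous G := intervalIntegral.continuous_primitive hgi' 0
  have hGp : Function.Periodic G T := by
    intro t
    have e1 := hgp.intervalIntegral_add_eq t 0
    rw [zero_add, hmean] at e1
    have := intervalIntegral.integral_add_adjacent_intervals (hgi' 0 t) (hgi' t (t + T))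
    simp only [hG]
    rw [← this, e1, add_zero]
  let u : C(AddCircle T, EuclideanSpace ℝ (Fin n)) :=
    ⟨hGp.lift, continuous_quot_lift _ hGc⟩
  have hu : ∀ t : ℝ, u (t : AddCircle T) = G t := fun t => rfl
  have hum : MemLp u 2 (volume : Measure (AddCircle T)) :=
    u.continuous.memLp_of_hasCompactSupport (HasCompactSupport.of_compactSpace u)
  have parts : ∀ φ : ℝ → ℝ, ContDiff ℝ ∞ φ → Function.Periodic φ T →
      ∫ t in (0 : ℝ)..T, deriv φ t • u (t : AddCircle T) =
        -∫ t in (0 : ℝ)..T, φ t • g (t : AddCircle T) := by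
    intro φ h1 h2
    have hdc : Continuous (deriv φ) := h1.continuous_deriv (by simp)
    ext i
    rw [PiLp.neg_apply, integral_coord
      ((intervalIntegrable_of_memLp hum).continuousOn_smul hdc.continuousOn),
      integral_coord (hgi.continuousOn_smul h1.continuous.continuousOn)]
    simp only [hu, PiLp.smul_apply, smul_eq_mul]
    have hgci : IntervalIntegrable (fun t : ℝ => g (t : AddCircle T) i) volume 0 T :=
      intervalIntegrable_of_memLp (memLp_coord (Lp.memLp g) i)
    have hGi : ∀ t, G t i = ∫ s in (0 : ℝ)..t, g (s : AddCircle T) i :=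
      fun t => integral_coord (hgi' 0 t) i
    have ac1 : AbsolutelyContinuousOnInterval φ 0 T :=
      ContDiffOn.absolutelyContinuousOnInterval (h1.of_le (by simp)).contDiffOn
    have ac2 : AbsolutelyContinuousOnInterval (fun t => G t i) 0 T := by
      simp only [hGi]
      exact hgci.absolutelyContinuousOnInterval_intervalIntegral (by simp)
    have ibp := AbsolutelyContinuousOnInterval.integral_mul_deriv_eq_deriv_mul ac1 ac2
    have hGT : G T = G 0 := by simpa using hGp 0
    have hφT : φ T = φ 0 := by simpa using h2 0
    have hae : ∫ t in (0 : ℝ)..T, φ t * deriv (fun t => G t i) t =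
        ∫ t in (0 : ℝ)..T, φ t * g (t : AddCircle T) i := by
      apply intervalIntegral.integral_congr_ae
      filter_upwards [hgci.ae_hasDerivAt_integral] with t ht ht'
      have := ht (uIoc_subset_uIcc ht') 0 (by simp)
      simp only [hGi]
      rw [this.deriv]
    rw [hae, hGT, hφT, sub_self, zero_sub] at ibp
    rw [ibp, neg_neg]
  obtain ⟨c, hc⟩ := ae_const_of_weakDeriv_zero ((Lp.memLp q).sub hum) (fun φ h1 h2 => by
    have hdc : Continuous (deriv φ) := h1.continuous_deriv (by simp)
    simp only [Pi.sub_apply, smul_sub]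
    rw [intervalIntegral.integral_sub
      ((intervalIntegrable_of_memLp (Lp.memLp q)).continuousOn_smul hdc.continuousOn)
      ((intervalIntegrable_of_memLp hum).continuousOn_smul hdc.continuousOn),
      h φ h1 h2, parts φ h1 h2, sub_self])
  refine ⟨u + ContinuousMap.const _ c, ?_⟩
  filter_upwards [hc] with x hx
  simp only [Pi.sub_apply] at hx
  simp [← hx]

/-- The linear space of all `q ∈ L²(ℝ/Tℤ, ℝⁿ)` that have a weak derivative in `L²`. -/
def submodule (T : ℝ) [Fact (0 < T)] (n : ℕ) : Submodule ℝ (L2 T n) where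
  carrier := {q | ∃ g : L2 T n, IsWeakDeriv q g}
  add_mem' := fun ⟨g, hg⟩ ⟨g', hg'⟩ => ⟨g + g', hg.add hg'⟩
  zero_mem' := ⟨0, IsWeakDeriv.zero⟩
  smul_mem' := fun c _ ⟨g, hg⟩ => ⟨c • g, hg.smul c⟩

/-- The Sobolev space `H¹ = W^{1,2}(ℝ/Tℤ, ℝⁿ)`. It is a type of its own, so that it does not
inherit the norm of `L²`. -/
def H1 (T : ℝ) [Fact (0 < T)] (n : ℕ) : Type := submodule T n

instance : AddCommGroup (H1 T n) := inferInstanceAs (AddCommGroup (submodule T n))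

instance : Module ℝ (H1 T n) := inferInstanceAs (Module ℝ (submodule T n))

namespace H1

/-- The underlying class in `L²`. -/
def toL2 (q : H1 T n) : L2 T n := Subtype.val q

lemma toL2_injective : Function.Injective (toL2 (T := T) (n := n)) := Subtype.val_injective

lemma toL2_add (p q : H1 T n) : (p + q).toL2 = p.toL2 + q.toL2 := rfl

lemma toL2_smul (c : ℝ) (q : H1 T n) : (c • q).toL2 = c • q.toL2 := rfl

lemma toL2_zero : (0 : H1 T n).toL2 = 0 := rfl

lemma exists_weakDeriv (q : H1 T n) : ∃ g : L2 T n, IsWeakDeriv q.toL2 g := Subtype.property q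

/-- The weak derivative `q̇`, which is unique. -/
def weakDeriv (q : H1 T n) : L2 T n := q.exists_weakDeriv.choose

lemma isWeakDeriv (q : H1 T n) : IsWeakDeriv q.toL2 q.weakDeriv := q.exists_weakDeriv.choose_spec

lemma weakDeriv_eq {q : H1 T n} {g : L2 T n} (h : IsWeakDeriv q.toL2 g) : q.weakDeriv = g :=
  q.isWeakDeriv.unique h

lemma weakDeriv_add (p q : H1 T n) : (p + q).weakDeriv = p.weakDeriv + q.weakDeriv :=
  weakDeriv_eq (p.isWeakDeriv.add q.isWeakDeriv)

lemma weakDeriv_smul (c : ℝ) (q : H1 T n) : (c • q).weakDeriv = c • q.weakDeriv :=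
  weakDeriv_eq (q.isWeakDeriv.smul c)

/-- The continuous representative of `q`, which is unique. -/
def rep (q : H1 T n) : C(AddCircle T, EuclideanSpace ℝ (Fin n)) :=
  (exists_continuous_rep q.isWeakDeriv).choose

lemma coeFn_ae_eq_rep (q : H1 T n) : q.toL2 =ᵐ[volume] q.rep :=
  (exists_continuous_rep q.isWeakDeriv).choose_spec

lemma rep_eq {q : H1 T n} {u : C(AddCircle T, EuclideanSpace ℝ (Fin n))}
    (h : q.toL2 =ᵐ[volume] u) : q.rep = u :=
  DFunLike.coe_injective
    ((Continuous.ae_eq_iff_eq volume q.rep.continuous u.continuous).1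
      (q.coeFn_ae_eq_rep.symm.trans h))

lemma rep_add (p q : H1 T n) : (p + q).rep = p.rep + q.rep := by
  apply rep_eq
  rw [toL2_add]
  filter_upwards [Lp.coeFn_add p.toL2 q.toL2, p.coeFn_ae_eq_rep, q.coeFn_ae_eq_rep]
    with x h1 h2 h3
  rw [h1, Pi.add_apply, h2, h3, ContinuousMap.add_apply]

lemma rep_smul (c : ℝ) (q : H1 T n) : (c • q).rep = c • q.rep := by
  apply rep_eq
  rw [toL2_smul]
  filter_upwards [Lp.coeFn_smul c q.toL2, q.coeFn_ae_eq_rep] with x h1 h2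
  rw [h1, Pi.smul_apply, h2, ContinuousMap.smul_apply]

/-- The norm `‖q‖ = (∫₀ᵀ |q̇|² dt)^{1/2} + |q(0)|` of `H¹`. -/
instance : Norm (H1 T n) := ⟨fun q => ‖q.weakDeriv‖ + ‖q.rep 0‖⟩

lemma norm_def (q : H1 T n) : ‖q‖ = ‖q.weakDeriv‖ + ‖q.rep 0‖ := rfl

lemma core : NormedSpace.Core ℝ (H1 T n) where
  norm_nonneg q := by rw [norm_def]; positivity
  norm_smul c q := by
    rw [norm_def, norm_def, weakDeriv_smul, rep_smul, norm_smul, ContinuousMap.smul_apply,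
      norm_smul, mul_add]
  norm_triangle p q := by
    rw [norm_def, norm_def, norm_def, weakDeriv_add, rep_add, ContinuousMap.add_apply]
    linarith [norm_add_le p.weakDeriv q.weakDeriv, norm_add_le (p.rep 0) (q.rep 0)]
  norm_eq_zero_iff q := by
    constructor
    · intro h
      rw [norm_def] at h
      have h1 : q.weakDeriv = 0 := norm_eq_zero.1 (by
        linarith [norm_nonneg q.weakDeriv, norm_nonneg (q.rep 0)])
      have h2 : q.rep 0 = 0 := norm_eq_zero.1 (by
        linarith [norm_nonneg q.weakDeriv, norm_nonneg (q.rep 0)])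
      obtain ⟨c, hc⟩ := ae_const_of_weakDeriv_zero (Lp.memLp q.toL2) (fun φ a b => by
        have e := q.isWeakDeriv φ a b
        rw [h1] at e
        rw [e, neg_eq_zero]
        apply intervalIntegral.integral_zero_ae
        filter_upwards [ae_coe (Lp.coeFn_zero (EuclideanSpace ℝ (Fin n)) 2
          (volume : Measure (AddCircle T)))] with t ht ht'
        rw [ht ht']; simp)
      have h3 : q.rep = ContinuousMap.const _ c := rep_eq hc
      have hc0 : c = 0 := by rw [h3] at h2; exact h2
      apply toL2_injective
      rw [toL2_zero]
      apply Lp.ext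
      filter_upwards [hc, Lp.coeFn_zero (EuclideanSpace ℝ (Fin n)) 2
          (volume : Measure (AddCircle T))] with x h5 h6
      rw [h5, h6, hc0]; rfl
    · rintro rfl
      have h1 : (0 : H1 T n).weakDeriv = 0 := weakDeriv_eq IsWeakDeriv.zero
      have h2 : (0 : H1 T n).rep = 0 := rep_eq (Lp.coeFn_zero _ _ _)
      rw [norm_def, h1, h2]; simp

instance : NormedAddCommGroup (H1 T n) := NormedAddCommGroup.ofCore core

instance : NormedSpace ℝ (H1 T n) := NormedSpace.ofCore core

end H1

/-- The action functional `f(q) = ½ ∫₀ᵀ |q̇|² dt - ∫₀ᵀ V(q) dt` on `H¹`. -/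
def action (V : EuclideanSpace ℝ (Fin n) → ℝ) (q : H1 T n) : ℝ :=
  (1 / 2) * (∫ t in (0 : ℝ)..T, ‖q.weakDeriv (t : AddCircle T)‖ ^ 2) -
    ∫ t in (0 : ℝ)..T, V (q.rep (t : AddCircle T))

end

end PeriodicSobolev

namespace Clarke

noncomputable section

variable {X : Type*} [NormedAddCommGroup X] [NormedSpace ℝ X]

/-- Clarke's generalized directional derivative
`f⁰(x, v) = limsup_{y → x, s ↓ 0} (f (y + s v) - f y) / s` of a locally Lipschitz function. -/
def dirDeriv (f : X → ℝ) (x v : X) : ℝ :=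
  limsup (fun p : X × ℝ => (f (p.1 + p.2 • v) - f p.1) / p.2) (𝓝 x ×ˢ 𝓝[>] (0 : ℝ))

/-- Clarke's generalized gradient `∂f(x) = {x* ∈ X* | ⟨x*, v⟩ ≤ f⁰(x, v) for all v}`. -/
def subdiff (f : X → ℝ) (x : X) : Set (StrongDual ℝ X) :=
  {ξ | ∀ v : X, ξ v ≤ dirDeriv f x v}

/-- `min {‖x*‖ | x* ∈ ∂f(x)}`. For locally Lipschitz `f` the set `∂f(x)` is nonempty and weak*
compact, so that the infimum is a minimum. -/
def minNorm (f : X → ℝ) (x : X) : ℝ :=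
  sInf ((fun ξ : StrongDual ℝ X => ‖ξ‖) '' subdiff f x)

/-- The Cerami-Palais-Smale-Chang condition at level `c` for a locally Lipschitz function. -/
def CPSCAt (f : X → ℝ) (c : ℝ) : Prop :=
  LocallyLipschitz f ∧
    ∀ x : ℕ → X, Tendsto (fun k => f (x k)) atTop (𝓝 c) →
      Tendsto (fun k => (1 + ‖x k‖) * minNorm f (x k)) atTop (𝓝 0) →
        ∃ (a : X) (σ : ℕ → ℕ), StrictMono σ ∧ Tendsto (fun k => x (σ k)) atTop (𝓝 a)

/-- The Cerami-Palais-Smale-Chang condition, at every level. -/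
def CPSC (f : X → ℝ) : Prop := ∀ c : ℝ, CPSCAt f c

end

end Clarke

/-! ### Clarke calculus for locally Lipschitz functions -/

namespace Clarke

section

variable {X : Type*} [NormedAddCommGroup X] [NormedSpace ℝ X]

/-! Take `ξ_k ∈ ∂f(q_k)` of almost minimal norm, so that `(1 + ‖q_k‖)‖ξ_k‖ → 0`. Everything follows
from testing `ξ_k` in two kinds of directions; only upper bounds of `f⁰` are needed, never a
representation of `∂f` by selections of `∂V`.

Boundedness: condition (V2) bounds `V⁰(x, -x)`, because `V⁰` is the support function of `∂V`
(Hahn-Banach, `exists_mem_subdiff`). Integrating over time bounds `f⁰(q, q)`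
(`dirDeriv_action_self_le`). Eliminating `∫ V(q)` by means of `f(q)` leaves `(μ₁/2 - 1)‖q̇‖² ≤ μ₁
f(q) - T μ₂ + ‖ξ‖‖q‖`. The Cerami weight bounds the last term before `q_k` is known to be bounded.
Hence `q̇_k` is bounded in `L²`, so `∫ V(q_k)` is bounded above, and the coercivity (V3) bounds
`q_k(0)`.

Compactness: by Rellich a subsequence converges uniformly. Testing `ξ_k` on `q_j - q_k` and `ξ_j` on
`q_k - q_j` and adding bounds `‖q̇_j - q̇_k‖²` by quantities tending to zero, so the derivatives are
Cauchy in `L²` (`exists_subseq_tendsto`). -/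

lemma tendsto_add_smul (x v : X) :
    Tendsto (fun p : X × ℝ => p.1 + p.2 • v) (𝓝 x ×ˢ 𝓝[>] (0 : ℝ)) (𝓝 x) := by
  have h : Tendsto (fun p : X × ℝ => p.1 + p.2 • v) (𝓝 (x, (0 : ℝ))) (𝓝 (x + (0 : ℝ) • v)) :=
    Continuous.tendsto (by fun_prop) (x, (0 : ℝ))
  rw [zero_smul, add_zero, nhds_prod_eq] at h
  exact h.mono_left (Filter.prod_mono le_rfl nhdsWithin_le_nhds)

lemma eventually_pos {X : Type*} [NormedAddCommGroup X] (x : X) :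
    ∀ᶠ p : X × ℝ in 𝓝 x ×ˢ 𝓝[>] (0 : ℝ), 0 < p.2 :=
  tendsto_snd.eventually self_mem_nhdsWithin

/-- The difference quotients of a locally Lipschitz function are bounded near every point. -/
lemma exists_eventually_abs_quotient_le {f : X → ℝ} (hf : LocallyLipschitz f) (x : X) :
    ∃ L : ℝ, 0 ≤ L ∧ ∀ v : X, ∀ᶠ p : X × ℝ in 𝓝 x ×ˢ 𝓝[>] (0 : ℝ),
      |(f (p.1 + p.2 • v) - f p.1) / p.2| ≤ L * ‖v‖ := by
  obtain ⟨K, s, hs, hK⟩ := hf x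
  refine ⟨K, K.2, fun v => ?_⟩
  filter_upwards [(tendsto_add_smul x v).eventually hs, tendsto_fst.eventually hs,
    eventually_pos x] with p h1 h2 h3
  have := hK.dist_le_mul _ h1 _ h2
  rw [dist_eq_norm, dist_eq_norm, add_sub_cancel_left, norm_smul, Real.norm_eq_abs,
    Real.norm_eq_abs, abs_of_pos h3] at this
  rw [abs_div, abs_of_pos h3, div_le_iff₀ h3]
  linarith

variable {f : X → ℝ}

/-- The real `limsup` is meaningful only for bounded quotients; the local Lipschitz constant
supplies the bound here and in the next lemma. -/
lemma dirDeriv_le (hf : LocallyLipschitz f) {x v : X} {b : ℝ}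
    (h : ∀ ε > 0, ∀ᶠ p : X × ℝ in 𝓝 x ×ˢ 𝓝[>] (0 : ℝ),
      (f (p.1 + p.2 • v) - f p.1) / p.2 ≤ b + ε) : dirDeriv f x v ≤ b := by
  obtain ⟨L, -, hL⟩ := exists_eventually_abs_quotient_le hf x
  refine le_of_forall_pos_le_add fun ε hε => limsup_le_of_le ?_ (h ε hε)
  exact isCoboundedUnder_le_of_eventually_le _ (x := -(L * ‖v‖))
    ((hL v).mono fun p hp => (abs_le.1 hp).1)

lemma eventually_lt_of_dirDeriv_lt (hf : LocallyLipschitz f) {x v : X} {b : ℝ}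
    (h : dirDeriv f x v < b) : ∀ᶠ p : X × ℝ in 𝓝 x ×ˢ 𝓝[>] (0 : ℝ),
      (f (p.1 + p.2 • v) - f p.1) / p.2 < b := by
  obtain ⟨L, -, hL⟩ := exists_eventually_abs_quotient_le hf x
  exact eventually_lt_of_limsup_lt h
    ⟨L * ‖v‖, eventually_map.2 ((hL v).mono fun p hp => (abs_le.1 hp).2)⟩

lemma dirDeriv_zero (x : X) : dirDeriv f x 0 = 0 := by
  simp [dirDeriv]

/-- The quotient splits at the intermediate point `y + s w`, which also tends to `x`; this is where
the free base point in `f⁰` matters. -/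
lemma dirDeriv_add_le (hf : LocallyLipschitz f) (x v w : X) :
    dirDeriv f x (v + w) ≤ dirDeriv f x v + dirDeriv f x w := by
  refine dirDeriv_le hf fun ε hε => ?_
  have h1 := eventually_lt_of_dirDeriv_lt hf (lt_add_of_pos_right (dirDeriv f x v) (half_pos hε))
  have h2 := eventually_lt_of_dirDeriv_lt hf (lt_add_of_pos_right (dirDeriv f x w) (half_pos hε))
  have h3 : Tendsto (fun p : X × ℝ => (p.1 + p.2 • w, p.2)) (𝓝 x ×ˢ 𝓝[>] (0 : ℝ))
      (𝓝 x ×ˢ 𝓝[>] (0 : ℝ)) := (tendsto_add_smul x w).prodMk tendsto_snd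
  filter_upwards [h3.eventually h1, h2] with p e1 e2
  have : p.1 + p.2 • (v + w) = p.1 + p.2 • w + p.2 • v := by rw [smul_add]; abel
  rw [this]
  rw [show f (p.1 + p.2 • w + p.2 • v) - f p.1 = (f (p.1 + p.2 • w + p.2 • v) - f (p.1 + p.2 • w))
    + (f (p.1 + p.2 • w) - f p.1) by ring, add_div]
  linarith

lemma dirDeriv_smul_le (hf : LocallyLipschitz f) {c : ℝ} (hc : 0 < c) (x v : X) :
    dirDeriv f x (c • v) ≤ c * dirDeriv f x v := by
  refine dirDeriv_le hf fun ε hε => ?_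
  have h1 := eventually_lt_of_dirDeriv_lt hf
    (lt_add_of_pos_right (dirDeriv f x v) (div_pos hε hc))
  have h2 : Tendsto (fun s : ℝ => s * c) (𝓝[>] 0) (𝓝[>] 0) := by
    refine tendsto_nhdsWithin_iff.2 ⟨?_, ?_⟩
    · have : Tendsto (fun s : ℝ => s * c) (𝓝 0) (𝓝 (0 * c)) := Continuous.tendsto (by fun_prop) 0
      rw [zero_mul] at this
      exact this.mono_left nhdsWithin_le_nhds
    · filter_upwards [self_mem_nhdsWithin] with s hs
      exact mul_pos hs hc
  have h3 : Tendsto (fun p : X × ℝ => (p.1, p.2 * c)) (𝓝 x ×ˢ 𝓝[>] (0 : ℝ))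
      (𝓝 x ×ˢ 𝓝[>] (0 : ℝ)) := tendsto_fst.prodMk (h2.comp tendsto_snd)
  filter_upwards [h3.eventually h1, eventually_pos x] with p e1 e2
  simp only [mul_smul] at e1
  have e3 := mul_le_mul_of_nonneg_left e1.le hc.le
  rw [mul_add, mul_div_cancel₀ _ hc.ne'] at e3
  refine le_of_eq_of_le ?_ e3
  field_simp

lemma dirDeriv_smul (hf : LocallyLipschitz f) {c : ℝ} (hc : 0 < c) (x v : X) :
    dirDeriv f x (c • v) = c * dirDeriv f x v := by
  refine le_antisymm (dirDeriv_smul_le hf hc x v) ?_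
  have := dirDeriv_smul_le hf (inv_pos.2 hc) x (c • v)
  rw [inv_smul_smul₀ hc.ne', inv_mul_eq_div, le_div_iff₀ hc] at this
  linarith

/-- The generalized directional derivative is the support function of the generalized gradient,
and the supremum is attained. -/
lemma exists_mem_subdiff (hf : LocallyLipschitz f) (x v : X) :
    ∃ ξ ∈ subdiff f x, ξ v = dirDeriv f x v := by
  -- Hahn-Banach: the functional `c v ↦ c f⁰(x, v)` on the line through `v` is dominated by the
  -- sublinear `f⁰(x, ·)` and extends under it.
  let F : X →ₗ.[ℝ] ℝ := LinearPMap.mkSpanSingleton' v (dirDeriv f x v) (by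
    intro c hc
    rcases eq_or_ne c 0 with rfl | h
    · simp
    · rw [(smul_eq_zero_iff_right h).1 hc, dirDeriv_zero, smul_zero])
  have hF : ∀ c : ℝ, ∀ h, F ⟨c • v, h⟩ = c * dirDeriv f x v := fun c h =>
    LinearPMap.mkSpanSingleton'_apply v (dirDeriv f x v) _ c h
  obtain ⟨g, hg1, hg2⟩ := exists_extension_of_le_sublinear F (dirDeriv f x)
    (fun c hc w => dirDeriv_smul hf hc x w) (dirDeriv_add_le hf x) (by
      rintro ⟨w, hw⟩
      obtain ⟨c, rfl⟩ := Submodule.mem_span_singleton.1 hw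
      rw [hF]
      rcases lt_trichotomy c 0 with h | rfl | h
      -- For negative `c`, domination comes from `0 = f⁰(x, c v - c v) ≤ f⁰(x, c v) + f⁰(x, -c v)`.
      · have h1 := dirDeriv_add_le hf x (c • v) ((-c) • v)
        rw [dirDeriv_smul hf (neg_pos.2 h), neg_smul, add_neg_cancel, dirDeriv_zero] at h1
        simp only
        linarith
      · simp [dirDeriv_zero]
      · exact (dirDeriv_smul hf h x v).ge)
  obtain ⟨L, hL0, hL⟩ := exists_eventually_abs_quotient_le hf x
  have hb : ∀ w, dirDeriv f x w ≤ L * ‖w‖ := fun w => dirDeriv_le hf fun ε hε =>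
    (hL w).mono fun p hp => (abs_le.1 hp).2.trans (by linarith)
  refine ⟨g.mkContinuous L fun w => ?_, hg2, ?_⟩
  · rw [Real.norm_eq_abs, abs_le]
    constructor
    · have := (hg2 (-w)).trans (hb (-w))
      rw [map_neg, norm_neg] at this
      linarith
    · exact (hg2 w).trans (hb w)
  · have h1 := hg1 ⟨v, Submodule.mem_span_singleton_self v⟩
    have h2 := hF 1 (by rw [one_smul]; exact Submodule.mem_span_singleton_self v)
    simp only [one_smul, one_mul] at h2
    rw [LinearMap.mkContinuous_apply, h1, h2]

/-- Almost minimizers suffice, so weak* compactness of `∂f(x)` is not needed; nonemptiness is, since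
`sInf ∅ = 0`. -/
lemma exists_norm_lt_minNorm_add (hf : LocallyLipschitz f) (x : X) {ε : ℝ} (hε : 0 < ε) :
    ∃ ξ ∈ subdiff f x, ‖ξ‖ < minNorm f x + ε := by
  obtain ⟨ξ, hξ, -⟩ := exists_mem_subdiff hf x 0
  obtain ⟨_, ⟨η, hη, rfl⟩, h⟩ := Real.lt_sInf_add_pos
    (s := (fun ξ : StrongDual ℝ X => ‖ξ‖) '' subdiff f x) ⟨_, ξ, hξ, rfl⟩ hε
  exact ⟨η, hη, h⟩

end

end Clarke

/-! ### Integrals and primitives of `L²` functions on the circle -/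

namespace PeriodicSobolev

section

variable {T : ℝ} [hT : Fact (0 < T)] {n : ℕ}

lemma norm_sq_eq_intervalIntegral (g : L2 T n) (s : ℝ) :
    ‖g‖ ^ 2 = ∫ t in s..(s + T), ‖g (t : AddCircle T)‖ ^ 2 := by
  rw [← real_inner_self_eq_norm_sq, L2.inner_def,
    ← AddCircle.intervalIntegral_preimage T s]
  simp only [real_inner_self_eq_norm_sq]

lemma intervalIntegrable_lift (g : L2 T n) (a b : ℝ) :
    IntervalIntegrable (fun t : ℝ => g (t : AddCircle T)) volume a b := by
  have hgp : Function.Periodic (fun t : ℝ => g (t : AddCircle T)) T := fun t => by simp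
  exact hgp.intervalIntegrable₀ hT.out.ne' (intervalIntegrable_of_memLp (Lp.memLp g)) a b

lemma intervalIntegrable_norm_sq (g : L2 T n) (a b : ℝ) :
    IntervalIntegrable (fun t : ℝ => ‖g (t : AddCircle T)‖ ^ 2) volume a b := by
  have hgp : Function.Periodic (fun t : ℝ => ‖g (t : AddCircle T)‖ ^ 2) T := fun t => by simp
  refine hgp.intervalIntegrable₀ hT.out.ne' ?_ a b
  rw [intervalIntegrable_iff_integrableOn_Ioc_of_le hT.out.le]
  have := (AddCircle.measurePreserving_mk T 0).integrable_comp_of_integrable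
    ((Lp.memLp g).integrable_norm_pow (by norm_num))
  simpa [IntegrableOn, Function.comp_def] using this

/-- Cauchy-Schwarz in the form obtained from Young's inequality with a parameter. -/
lemma norm_integral_le_young (g : L2 T n) {s t a : ℝ} (hst : s ≤ t) (htT : t ≤ s + T)
    (ha : 0 < a) : ‖∫ r in s..t, g (r : AddCircle T)‖ ≤ (t - s) / (2 * a) + a / 2 * ‖g‖ ^ 2 := by
  have i2 := (intervalIntegrable_norm_sq g s t).const_mul (a / 2)
  have i1 : IntervalIntegrable (fun _ : ℝ => 1 / (2 * a)) volume s t := by simp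
  calc ‖∫ r in s..t, g (r : AddCircle T)‖
      ≤ ∫ r in s..t, ‖g (r : AddCircle T)‖ := intervalIntegral.norm_integral_le_integral_norm hst
    _ ≤ ∫ r in s..t, (1 / (2 * a) + a / 2 * ‖g (r : AddCircle T)‖ ^ 2) := by
        refine intervalIntegral.integral_mono_on hst (intervalIntegrable_lift g s t).norm
          (i1.add i2) fun r _ => ?_
        have h := sq_nonneg (a * ‖g (r : AddCircle T)‖ - 1)
        have : 1 / (2 * a) + a / 2 * ‖g (r : AddCircle T)‖ ^ 2 - ‖g (r : AddCircle T)‖ =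
            (a * ‖g (r : AddCircle T)‖ - 1) ^ 2 / (2 * a) := by field_simp; ring
        have h2 : 0 ≤ (a * ‖g (r : AddCircle T)‖ - 1) ^ 2 / (2 * a) := by positivity
        linarith
    _ = (t - s) / (2 * a) + a / 2 * ∫ r in s..t, ‖g (r : AddCircle T)‖ ^ 2 := by
        rw [intervalIntegral.integral_add i1 i2, intervalIntegral.integral_const,
          intervalIntegral.integral_const_mul, smul_eq_mul, mul_one_div]
    _ ≤ _ := by
        rw [norm_sq_eq_intervalIntegral g s]
        gcongr
        refine intervalIntegral.integral_mono_interval le_rfl hst htT ?_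
          (intervalIntegrable_norm_sq g s (s + T))
        exact Eventually.of_forall fun r => by positivity

/-- Young's inequality with `a = 1 / b`, then `b ↓ ‖g‖`; the limit also covers `‖g‖ = 0`. -/
lemma norm_integral_le (g : L2 T n) {s t : ℝ} (hst : s ≤ t) (htT : t ≤ s + T) :
    ‖∫ r in s..t, g (r : AddCircle T)‖ ≤ (T + 1) / 2 * ‖g‖ := by
  have key : ∀ b > ‖g‖, ‖∫ r in s..t, g (r : AddCircle T)‖ ≤ (T + 1) / 2 * b := fun b hb => by
    have hb0 : 0 < b := (norm_nonneg g).trans_lt hb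
    refine (norm_integral_le_young g hst htT (inv_pos.2 hb0)).trans ?_
    have h1 : (t - s) / (2 * b⁻¹) = (t - s) / 2 * b := by field_simp
    have h2 : b⁻¹ / 2 * ‖g‖ ^ 2 ≤ b⁻¹ / 2 * b ^ 2 := by gcongr
    have h3 : b⁻¹ / 2 * b ^ 2 = b / 2 := by field_simp
    rw [h1]
    nlinarith
  have h := (continuous_const.mul continuous_id : Continuous fun b : ℝ => (T + 1) / 2 * b)
  refine ge_of_tendsto (h.continuousWithinAt (s := Ioi ‖g‖) (x := ‖g‖)) ?_
  filter_upwards [self_mem_nhdsWithin] with b hb using key b hb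

/-- Integrals of an `L²` function depend continuously on it. -/
lemma tendsto_integral_lift {g : ℕ → L2 T n} {g₀ : L2 T n} (h : Tendsto g atTop (𝓝 g₀)) {s t : ℝ}
    (hst : s ≤ t) (htT : t ≤ s + T) :
    Tendsto (fun k => ∫ r in s..t, g k (r : AddCircle T)) atTop
      (𝓝 (∫ r in s..t, g₀ (r : AddCircle T))) := by
  refine tendsto_iff_norm_sub_tendsto_zero.2 (squeeze_zero (fun _ => norm_nonneg _) (fun k => ?_)
    (by simpa using (tendsto_iff_norm_sub_tendsto_zero.1 h).const_mul ((T + 1) / 2)))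
  refine le_of_eq_of_le ?_ (norm_integral_le (g k - g₀) hst htT)
  rw [← intervalIntegral.integral_sub (intervalIntegrable_lift _ _ _)
    (intervalIntegrable_lift _ _ _)]
  congr 1
  refine intervalIntegral.integral_congr_ae ?_
  have h1 := (AddCircle.measurePreserving_mk T s).quasiMeasurePreserving.ae
    (Lp.coeFn_sub (g k) g₀)
  filter_upwards [(ae_restrict_iff' measurableSet_Ioc).1 h1] with r hr hr'
  rw [uIoc_of_le hst] at hr'
  exact (hr ⟨hr'.1, hr'.2.trans htT⟩).symm

/-- The primitive of a mean-zero `L²` function is an element of `H¹`. -/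
lemma exists_of_mean_zero (g : L2 T n) (hmean : ∫ t in (0 : ℝ)..T, g (t : AddCircle T) = 0)
    (c : EuclideanSpace ℝ (Fin n)) :
    ∃ q : H1 T n, q.weakDeriv = g ∧
      ∀ t : ℝ, q.rep (t : AddCircle T) = c + ∫ s in (0 : ℝ)..t, g (s : AddCircle T) := by
  have hgi := intervalIntegrable_of_memLp (Lp.memLp g)
  have hgp : Function.Periodic (fun t : ℝ => g (t : AddCircle T)) T := fun t => by simp
  have hgi' := intervalIntegrable_lift g
  set G : ℝ → EuclideanSpace ℝ (Fin n) := fun t => c + ∫ s in (0 : ℝ)..t, g (s : AddCircle T)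
    with hG
  have hGc : Continuous G := continuous_const.add (intervalIntegral.continuous_primitive hgi' 0)
  -- The vanishing mean makes the primitive periodic, so that it descends to the circle and the
  -- boundary terms below cancel.
  have hGp : Function.Periodic G T := by
    intro t
    have e1 := hgp.intervalIntegral_add_eq t 0
    rw [zero_add, hmean] at e1
    have := intervalIntegral.integral_add_adjacent_intervals (hgi' 0 t) (hgi' t (t + T))
    simp only [hG]
    rw [← this, e1, add_zero]
  let u : C(AddCircle T, EuclideanSpace ℝ (Fin n)) := ⟨hGp.lift, continuous_quot_lift _ hGc⟩
  have hu : ∀ t : ℝ, u (t : AddCircle T) = G t := fun t => rfl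
  have hum : MemLp u 2 (volume : Measure (AddCircle T)) :=
    u.continuous.memLp_of_hasCompactSupport (HasCompactSupport.of_compactSpace u)
  have parts : ∀ φ : ℝ → ℝ, ContDiff ℝ ∞ φ → Function.Periodic φ T →
      ∫ t in (0 : ℝ)..T, deriv φ t • u (t : AddCircle T) =
        -∫ t in (0 : ℝ)..T, φ t • g (t : AddCircle T) := by
    intro φ h1 h2
    have hdc : Continuous (deriv φ) := h1.continuous_deriv (by simp)
    ext i
    rw [PiLp.neg_apply, integral_coord
      ((intervalIntegrable_of_memLp hum).continuousOn_smul hdc.continuousOn),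
      integral_coord (hgi.continuousOn_smul h1.continuous.continuousOn)]
    simp only [hu, PiLp.smul_apply, smul_eq_mul]
    have hgci : IntervalIntegrable (fun t : ℝ => g (t : AddCircle T) i) volume 0 T :=
      intervalIntegrable_of_memLp (memLp_coord (Lp.memLp g) i)
    have hGi : ∀ t, G t i = c i + ∫ s in (0 : ℝ)..t, g (s : AddCircle T) i :=
      fun t => by simp only [hG, PiLp.add_apply, integral_coord (hgi' 0 t) i]
    have ac1 : AbsolutelyContinuousOnInterval φ 0 T :=
      ContDiffOn.absolutelyContinuousOnInterval (h1.of_le (by simp)).contDiffOn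
    have ac2 : AbsolutelyContinuousOnInterval (fun t => G t i) 0 T := by
      simp only [hGi]
      exact (ContDiffOn.absolutelyContinuousOnInterval contDiffOn_const).add
        (hgci.absolutelyContinuousOnInterval_intervalIntegral (by simp))
    have ibp := AbsolutelyContinuousOnInterval.integral_mul_deriv_eq_deriv_mul ac1 ac2
    have hGT : G T = G 0 := by simpa using hGp 0
    have hφT : φ T = φ 0 := by simpa using h2 0
    have hae : ∫ t in (0 : ℝ)..T, φ t * deriv (fun t => G t i) t =
        ∫ t in (0 : ℝ)..T, φ t * g (t : AddCircle T) i := by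
      apply intervalIntegral.integral_congr_ae
      filter_upwards [hgci.ae_hasDerivAt_integral] with t ht ht'
      have := (ht (uIoc_subset_uIcc ht') 0 (by simp)).const_add (c i)
      simp only [hGi]
      rw [this.deriv]
    rw [hae, hGT, hφT, sub_self, zero_sub] at ibp
    rw [ibp, neg_neg]
  have hw : IsWeakDeriv (hum.toLp u) g := by
    intro φ h1 h2
    rw [← parts φ h1 h2]
    apply intervalIntegral.integral_congr_ae
    filter_upwards [ae_coe hum.coeFn_toLp] with t ht ht'
    rw [ht ht']
  let q : H1 T n := ⟨hum.toLp u, g, hw⟩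
  have hr : q.rep = u := H1.rep_eq hum.coeFn_toLp
  exact ⟨q, H1.weakDeriv_eq hw, fun t => by rw [hr]; rfl⟩

/-! ### Sobolev embedding, completeness and Rellich compactness of `H¹` -/

namespace H1

lemma weakDeriv_sub (p q : H1 T n) : (p - q).weakDeriv = p.weakDeriv - q.weakDeriv := by
  rw [eq_sub_iff_add_eq, ← weakDeriv_add, sub_add_cancel]

lemma rep_sub (p q : H1 T n) : (p - q).rep = p.rep - q.rep := by
  rw [eq_sub_iff_add_eq, ← rep_add, sub_add_cancel]

lemma integral_weakDeriv (q : H1 T n) :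
    ∫ t in (0 : ℝ)..T, q.weakDeriv (t : AddCircle T) = 0 := by
  simpa using (q.isWeakDeriv (fun _ => 1) contDiff_const (fun _ => rfl)).symm

lemma ext_weakDeriv {p q : H1 T n} (h : p.weakDeriv = q.weakDeriv) (h0 : p.rep 0 = q.rep 0) :
    p = q := by
  rw [← sub_eq_zero, ← norm_eq_zero, norm_def, weakDeriv_sub, rep_sub, h,
    ContinuousMap.sub_apply, h0]
  simp

/-- The fundamental theorem of calculus in `H¹`. -/
lemma rep_eq_add_integral (q : H1 T n) (t : ℝ) :
    q.rep (t : AddCircle T) = q.rep 0 + ∫ s in (0 : ℝ)..t, q.weakDeriv (s : AddCircle T) := by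
  obtain ⟨p, hp, hp'⟩ := exists_of_mean_zero q.weakDeriv q.integral_weakDeriv (q.rep 0)
  have : p = q := ext_weakDeriv hp (by simpa using hp' 0)
  rw [this] at hp'
  exact hp' t

lemma rep_sub_rep (q : H1 T n) (s t : ℝ) :
    q.rep (t : AddCircle T) - q.rep (s : AddCircle T) =
      ∫ r in s..t, q.weakDeriv (r : AddCircle T) := by
  rw [rep_eq_add_integral q t, rep_eq_add_integral q s, add_sub_add_left_eq_sub,
    intervalIntegral.integral_interval_sub_left (intervalIntegrable_lift _ _ _)
      (intervalIntegrable_lift _ _ _)]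

/-- With representatives in `[0, T)` the two points are joined by an interval shorter than a period.
-/
lemma norm_rep_sub_rep_le (q : H1 T n) (x y : AddCircle T) :
    ‖q.rep x - q.rep y‖ ≤ (T + 1) / 2 * ‖q.weakDeriv‖ := by
  obtain ⟨s, hs, rfl⟩ := AddCircle.coe_image_Ico_eq T 0 ▸ mem_univ x
  obtain ⟨t, ht, rfl⟩ := AddCircle.coe_image_Ico_eq T 0 ▸ mem_univ y
  rw [zero_add] at hs ht
  rcases le_total s t with h | h
  · rw [norm_sub_rev, rep_sub_rep]
    exact norm_integral_le _ h (by linarith [hs.1, ht.2])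
  · rw [rep_sub_rep]
    exact norm_integral_le _ h (by linarith [ht.1, hs.2])

lemma norm_rep_le (q : H1 T n) : ‖q.rep‖ ≤ ((T + 1) / 2 + 1) * ‖q‖ := by
  have hT0 := hT.out
  rw [ContinuousMap.norm_le _ (by positivity)]
  intro x
  have h1 := norm_rep_sub_rep_le q x 0
  have h2 := norm_add_le (q.rep x - q.rep 0) (q.rep 0)
  rw [sub_add_cancel] at h2
  rw [norm_def]
  nlinarith [norm_nonneg q.weakDeriv, norm_nonneg (q.rep 0)]

/-- The Sobolev embedding of `H¹` in the space of continuous functions. -/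
noncomputable def repL (T : ℝ) [Fact (0 < T)] (n : ℕ) :
    H1 T n →L[ℝ] C(AddCircle T, EuclideanSpace ℝ (Fin n)) :=
  LinearMap.mkContinuous
    { toFun := rep, map_add' := rep_add, map_smul' := rep_smul } ((T + 1) / 2 + 1) norm_rep_le

lemma repL_apply (q : H1 T n) : repL T n q = q.rep := rfl

lemma norm_weakDeriv_le (q : H1 T n) : ‖q.weakDeriv‖ ≤ ‖q‖ := by
  rw [norm_def]; linarith [norm_nonneg (q.rep 0)]

/-- Differentiation as a bounded operator from `H¹` to `L²`. -/
noncomputable def weakDerivL (T : ℝ) [Fact (0 < T)] (n : ℕ) : H1 T n →L[ℝ] L2 T n :=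
  LinearMap.mkContinuous
    { toFun := weakDeriv, map_add' := weakDeriv_add, map_smul' := weakDeriv_smul } 1
    fun q => by rw [one_mul]; exact norm_weakDeriv_le q

lemma weakDerivL_apply (q : H1 T n) : weakDerivL T n q = q.weakDeriv := rfl

/-- A sequence in `H¹` whose derivatives converge in `L²` and whose values at `0` converge is
convergent. -/
lemma exists_tendsto {q : ℕ → H1 T n} {g : L2 T n} {c : EuclideanSpace ℝ (Fin n)}
    (hg : Tendsto (fun k => (q k).weakDeriv) atTop (𝓝 g))
    (hc : Tendsto (fun k => (q k).rep 0) atTop (𝓝 c)) : ∃ a, Tendsto q atTop (𝓝 a) := by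
  have hT0 := hT.out
  -- Vanishing mean passes to `L²` limits, so the limit derivative has a periodic primitive.
  have hmean : ∫ t in (0 : ℝ)..T, g (t : AddCircle T) = 0 := by
    have h := tendsto_integral_lift hg (s := 0) (t := T) hT0.le (by simp)
    simp only [integral_weakDeriv] at h
    exact tendsto_nhds_unique h tendsto_const_nhds
  obtain ⟨a, ha, ha'⟩ := exists_of_mean_zero g hmean c
  have ha0 : a.rep 0 = c := by simpa using ha' 0
  refine ⟨a, tendsto_iff_norm_sub_tendsto_zero.2 ?_⟩
  simp only [norm_def, weakDeriv_sub, rep_sub, ContinuousMap.sub_apply, ha, ha0]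
  simpa using (tendsto_iff_norm_sub_tendsto_zero.1 hg).add (tendsto_iff_norm_sub_tendsto_zero.1 hc)

/-- Bounded sets of `H¹` are equicontinuous. -/
lemma equicontinuous_rep {ι : Type*} {q : ι → H1 T n} {M : ℝ}
    (hM : ∀ i, ‖(q i).weakDeriv‖ ≤ M) :
    Equicontinuous fun i (x : AddCircle T) => (q i).rep x := by
  have hT0 := hT.out
  intro x
  obtain ⟨s, rfl⟩ := QuotientAddGroup.mk_surjective x
  rw [Metric.equicontinuousAt_iff_right]
  intro ε hε
  rw [QuotientAddGroup.nhds_eq, eventually_map]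
  -- Young's parameter: the quadratic term stays below `ε / 2`, and `|t - s| < a ε` does the same
  -- for the linear one. The `+ 1` covers `M = 0`.
  set a : ℝ := ε / (M ^ 2 + 1) with ha
  have ha0 : 0 < a := by positivity
  have haM : a / 2 * M ^ 2 < ε / 2 := by
    rw [ha]
    have : ε / (M ^ 2 + 1) / 2 * M ^ 2 = ε / 2 * (M ^ 2 / (M ^ 2 + 1)) := by ring
    rw [this]
    have h : M ^ 2 / (M ^ 2 + 1) < 1 := (div_lt_one (by positivity)).2 (by linarith)
    nlinarith
  have hδ : 0 < min T (a * ε) := lt_min hT0 (by positivity)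
  filter_upwards [Metric.ball_mem_nhds s hδ] with t ht i
  rw [Metric.mem_ball, Real.dist_eq, lt_min_iff] at ht
  have key : ∀ s t : ℝ, s ≤ t → t - s < T → t - s < a * ε →
      ‖∫ r in s..t, (q i).weakDeriv (r : AddCircle T)‖ < ε := fun s t hst h1 h2 => by
    refine (norm_integral_le_young _ hst (by linarith) ha0).trans_lt ?_
    have h3 : (t - s) / (2 * a) ≤ ε / 2 := by
      rw [div_le_iff₀ (by positivity)]; linarith
    have h4 : a / 2 * ‖(q i).weakDeriv‖ ^ 2 ≤ a / 2 * M ^ 2 := by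
      have := hM i
      gcongr
    linarith
  change dist ((q i).rep (s : AddCircle T)) ((q i).rep (t : AddCircle T)) < ε
  rcases le_total s t with h | h
  · rw [abs_of_nonneg (by linarith)] at ht
    rw [dist_comm, dist_eq_norm, rep_sub_rep]
    exact key s t h ht.1 ht.2
  · rw [abs_of_nonpos (by linarith)] at ht
    rw [dist_eq_norm, rep_sub_rep]
    exact key t s h (by linarith) (by linarith)

/-- Rellich's theorem: bounded sequences of `H¹` have uniformly convergent subsequences. -/
lemma exists_subseq_tendsto_rep {q : ℕ → H1 T n} {M : ℝ} (hM : ∀ k, ‖q k‖ ≤ M) :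
    ∃ (u : C(AddCircle T, EuclideanSpace ℝ (Fin n))) (σ : ℕ → ℕ), StrictMono σ ∧
      Tendsto (fun k => (q (σ k)).rep) atTop (𝓝 u) := by
  have hT0 := hT.out
  let e := BoundedContinuousFunction.mkOfCompact (α := AddCircle T)
    (β := EuclideanSpace ℝ (Fin n))
  have hc := BoundedContinuousFunction.arzela_ascoli
    (Metric.closedBall (0 : EuclideanSpace ℝ (Fin n)) (((T + 1) / 2 + 1) * M))
    (isCompact_closedBall _ _) (range fun k => e (q k).rep) (by
      rintro _ x ⟨k, rfl⟩
      rw [mem_closedBall_zero_iff]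
      exact ((q k).rep.norm_coe_le_norm x).trans ((norm_rep_le (q k)).trans (by
        have := hM k
        gcongr))) (by
      have h := equicontinuous_rep (q := q) fun k => (norm_weakDeriv_le _).trans (hM k)
      intro x U hU
      filter_upwards [h x U hU] with y hy
      rintro ⟨_, k, rfl⟩
      exact hy k)
  obtain ⟨u, -, σ, hσ, hu⟩ := hc.tendsto_subseq fun k => subset_closure (mem_range_self k)
  refine ⟨(ContinuousMap.isometryEquivBoundedOfCompact _ _).symm u, σ, hσ, ?_⟩
  exact ((ContinuousMap.isometryEquivBoundedOfCompact (AddCircle T)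
    (EuclideanSpace ℝ (Fin n))).symm.continuous.tendsto u).comp hu

end H1

end

end PeriodicSobolev

/-! ### Generalized directional derivatives of the action -/

namespace PeriodicSobolev

section

variable {T : ℝ} [hT : Fact (0 < T)] {n : ℕ} {V : EuclideanSpace ℝ (Fin n) → ℝ}

lemma intervalIntegrable_comp_coe {T : ℝ} {b : AddCircle T → ℝ} (hb : Continuous b) (s t : ℝ) :
    IntervalIntegrable (fun r : ℝ => b (r : AddCircle T)) volume s t :=
  (hb.comp (AddCircle.continuous_mk' T)).intervalIntegrable s t

lemma action_eq (V : EuclideanSpace ℝ (Fin n) → ℝ) (q : H1 T n) :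
    action V q = 1 / 2 * ‖q.weakDeriv‖ ^ 2 - ∫ t in (0 : ℝ)..T, V (q.rep (t : AddCircle T)) := by
  rw [norm_sq_eq_intervalIntegral _ 0, zero_add]
  rfl

lemma exists_lipschitzOnWith_closedBall (hV : LocallyLipschitz V) (R : ℝ) :
    ∃ K, LipschitzOnWith K V (Metric.closedBall 0 R) :=
  hV.locallyLipschitzOn.exists_lipschitzOnWith_of_compact (isCompact_closedBall _ _)

/-- The increments of the potential energy are controlled by pointwise increments of `V`. -/
lemma integral_sub_integral_le (hV : Continuous V) {p q : C(AddCircle T, EuclideanSpace ℝ (Fin n))}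
    {b : AddCircle T → ℝ} (hb : Continuous b) (h : ∀ t, V (p t) - V (q t) ≤ b t) :
    (∫ t in (0 : ℝ)..T, V (p (t : AddCircle T))) - ∫ t in (0 : ℝ)..T, V (q (t : AddCircle T)) ≤
      ∫ t in (0 : ℝ)..T, b (t : AddCircle T) := by
  have ip := intervalIntegrable_comp_coe (hV.comp p.continuous) 0 T
  have iq := intervalIntegrable_comp_coe (hV.comp q.continuous) 0 T
  simp only [Function.comp_apply] at ip iq
  rw [← intervalIntegral.integral_sub ip iq]
  exact intervalIntegral.integral_mono_on hT.out.le (ip.sub iq)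
    (intervalIntegrable_comp_coe hb 0 T) fun t _ => h t

/-- The kinetic part is a difference of squares; for the potential part, the Sobolev embedding keeps
all values in one ball, where `V` is Lipschitz. -/
lemma locallyLipschitz_action (hV : LocallyLipschitz V) :
    LocallyLipschitz (action (T := T) V) := by
  have hT0 := hT.out
  intro q
  set R : ℝ := ‖q‖ + 1
  have hR : 0 ≤ R := by positivity
  set C : ℝ := (T + 1) / 2 + 1 with hC
  have hC0 : 0 ≤ C := by positivity
  obtain ⟨K, hK⟩ := exists_lipschitzOnWith_closedBall hV (C * R)
  refine ⟨Real.toNNReal (R + T * K * C), Metric.closedBall q 1,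
    Metric.closedBall_mem_nhds q one_pos, LipschitzOnWith.of_dist_le_mul ?_⟩
  have hbd : ∀ p ∈ Metric.closedBall q 1, ‖p‖ ≤ R := fun p hp => by
    rw [mem_closedBall_iff_norm] at hp
    linarith [norm_le_norm_add_norm_sub' p q]
  have key : ∀ p ∈ Metric.closedBall q 1, ∀ p' ∈ Metric.closedBall q 1,
      action V p - action V p' ≤ (R + T * K * C) * ‖p - p'‖ := by
    intro p hp p' hp'
    have hm : ∀ p ∈ Metric.closedBall q 1, ∀ t, p.rep t ∈ Metric.closedBall 0 (C * R) :=
      fun p hp t => by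
        rw [mem_closedBall_zero_iff]
        refine (p.rep.norm_coe_le_norm t).trans ((H1.norm_rep_le p).trans ?_)
        have := hbd p hp
        gcongr
    have h1 := integral_sub_integral_le (p := p'.rep) (q := p.rep) hV.continuous
      (b := fun _ => K * (C * ‖p - p'‖)) continuous_const fun t => by
        refine (le_abs_self _).trans ((hK.dist_le_mul _ (hm p' hp' t) _ (hm p hp t)).trans ?_)
        rw [dist_comm, dist_eq_norm]
        gcongr
        refine le_trans ?_ (H1.norm_rep_le (p - p'))
        rw [H1.rep_sub]
        exact (p.rep - p'.rep).norm_coe_le_norm t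
    rw [intervalIntegral.integral_const, smul_eq_mul, sub_zero] at h1
    have h2 : 1 / 2 * ‖p.weakDeriv‖ ^ 2 - 1 / 2 * ‖p'.weakDeriv‖ ^ 2 ≤ R * ‖p - p'‖ := by
      have e1 := norm_le_norm_add_norm_sub' p.weakDeriv p'.weakDeriv
      rw [← H1.weakDeriv_sub] at e1
      have e2 := H1.norm_weakDeriv_le (p - p')
      have e3 := (H1.norm_weakDeriv_le p).trans (hbd p hp)
      have e4 := (H1.norm_weakDeriv_le p').trans (hbd p' hp')
      have e5 : ‖p.weakDeriv‖ - ‖p'.weakDeriv‖ ≤ ‖p - p'‖ := by linarith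
      have e6 : 0 ≤ ‖p.weakDeriv‖ + ‖p'.weakDeriv‖ := by positivity
      nlinarith [mul_le_mul_of_nonneg_left e5 e6, norm_nonneg (p - p')]
    rw [action_eq, action_eq]
    linarith
  intro p hp p' hp'
  rw [Real.coe_toNNReal _ (by positivity), Real.dist_eq, dist_eq_norm, abs_le]
  have h1 := key p hp p' hp'
  have h2 := key p' hp' p hp
  rw [norm_sub_rev] at h2
  constructor <;> linarith

/-- Pointwise bounds of the difference quotients of `-V`, uniform in time, bound the generalized
directional derivative of the action. -/
lemma dirDeriv_action_le (hV : LocallyLipschitz V) {q v : H1 T n} {b : AddCircle T → ℝ}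
    (hb : Continuous b)
    (h : ∀ ε > 0, ∀ᶠ p : H1 T n × ℝ in 𝓝 q ×ˢ 𝓝[>] (0 : ℝ), ∀ t,
      V (p.1.rep t) - V (p.1.rep t + p.2 • v.rep t) ≤ p.2 * (b t + ε)) :
    Clarke.dirDeriv (action V) q v ≤
      inner ℝ q.weakDeriv v.weakDeriv + ∫ t in (0 : ℝ)..T, b (t : AddCircle T) := by
  have hT0 := hT.out
  refine Clarke.dirDeriv_le (locallyLipschitz_action hV) fun ε hε => ?_
  -- The difference quotient of the kinetic energy, computed exactly.
  have hlim : Tendsto (fun p : H1 T n × ℝ =>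
      inner ℝ p.1.weakDeriv v.weakDeriv + p.2 * (1 / 2 * ‖v.weakDeriv‖ ^ 2))
      (𝓝 q ×ˢ 𝓝[>] (0 : ℝ)) (𝓝 (inner ℝ q.weakDeriv v.weakDeriv)) := by
    have hc : Continuous (fun p : H1 T n × ℝ =>
        inner ℝ (H1.weakDerivL T n p.1) v.weakDeriv + p.2 * (1 / 2 * ‖v.weakDeriv‖ ^ 2)) := by
      fun_prop
    have := hc.tendsto (q, (0 : ℝ))
    simp only [H1.weakDerivL_apply, zero_mul, add_zero, nhds_prod_eq] at this
    exact this.mono_left (Filter.prod_mono le_rfl nhdsWithin_le_nhds)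
  -- After integration over a period the potential costs `ε / 2`; the kinetic part takes the other
  -- half.
  have hε2 : 0 < ε / (2 * T) := by positivity
  filter_upwards [h _ hε2, Clarke.eventually_pos q,
    hlim.eventually (gt_mem_nhds (lt_add_of_pos_right _ (half_pos hε)))] with p h1 h2 h3
  have h4 := integral_sub_integral_le (p := p.1.rep) (q := (p.1 + p.2 • v).rep) hV.continuous
    (b := fun t => p.2 * (b t + ε / (2 * T))) (by fun_prop) fun t => by
      rw [H1.rep_add, H1.rep_smul]
      exact h1 t
  rw [intervalIntegral.integral_const_mul, intervalIntegral.integral_add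
    (intervalIntegrable_comp_coe hb 0 T) (by simp), intervalIntegral.integral_const,
    smul_eq_mul, sub_zero, show T * (ε / (2 * T)) = ε / 2 by field_simp] at h4
  rw [action_eq, action_eq, div_le_iff₀ h2, H1.weakDeriv_add, H1.weakDeriv_smul,
    norm_add_sq_real, real_inner_smul_right, norm_smul, Real.norm_eq_abs, mul_pow, sq_abs]
  nlinarith

/-- A crude bound for the compactness step: the potential enters only through the sup norm of `v`,
which Rellich controls. The strict inequality `‖q.rep‖ < R` leaves room for nearby curves. -/
lemma dirDeriv_action_le_of_lipschitzOnWith (hV : LocallyLipschitz V) {q v : H1 T n} {K : NNReal}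
    {R : ℝ} (hK : LipschitzOnWith K V (Metric.closedBall 0 R)) (hR : ‖q.rep‖ < R) :
    Clarke.dirDeriv (action V) q v ≤
      inner ℝ q.weakDeriv v.weakDeriv + T * (K * ‖v.rep‖) := by
  have h := dirDeriv_action_le hV (q := q) (v := v) (b := fun _ => K * ‖v.rep‖)
    continuous_const fun ε hε => by
      have hc : ContinuousAt (fun p : H1 T n => ‖H1.repL T n p‖) q := by fun_prop
      have hN : ∀ᶠ p in 𝓝 q, ‖H1.repL T n p‖ < R := hc.eventually (gt_mem_nhds hR)
      filter_upwards [tendsto_fst.eventually hN, (Clarke.tendsto_add_smul q v).eventually hN,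
        Clarke.eventually_pos q] with p h1 h2 h3 t
      rw [H1.repL_apply] at h1 h2
      have m1 : p.1.rep t ∈ Metric.closedBall 0 R := by
        rw [mem_closedBall_zero_iff]
        exact (p.1.rep.norm_coe_le_norm t).trans h1.le
      have m2 : p.1.rep t + p.2 • v.rep t ∈ Metric.closedBall 0 R := by
        rw [mem_closedBall_zero_iff]
        have := ((p.1 + p.2 • v).rep.norm_coe_le_norm t).trans h2.le
        rwa [H1.rep_add, H1.rep_smul] at this
      refine (le_abs_self _).trans ((hK.dist_le_mul _ m1 _ m2).trans ?_)
      rw [dist_comm, dist_eq_norm, add_sub_cancel_left, norm_smul, Real.norm_eq_abs,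
        abs_of_pos h3]
      have h4 : K * (p.2 * ‖v.rep t‖) ≤ K * (p.2 * ‖v.rep‖) := by
        gcongr
        exact v.rep.norm_coe_le_norm t
      nlinarith [mul_pos h3 hε]
  rwa [intervalIntegral.integral_const, smul_eq_mul, sub_zero] at h

/-- The superquadraticity condition on `∂V` bounds the radial derivative of `-V`. -/
lemma dirDeriv_neg_le (hV : LocallyLipschitz V) {μ₁ μ₂ : ℝ}
    (hV2 : ∀ x : EuclideanSpace ℝ (Fin n), ∀ y ∈ Clarke.subdiff V x, μ₁ * V x + μ₂ ≤ y x)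
    (x : EuclideanSpace ℝ (Fin n)) : Clarke.dirDeriv V x (-x) ≤ -(μ₁ * V x + μ₂) := by
  obtain ⟨ξ, hξ, h⟩ := Clarke.exists_mem_subdiff hV x (-x)
  rw [← h, map_neg]
  linarith [hV2 x ξ hξ]

/-- The increment is a quotient in direction `-x` based at `x + h + s x`, so it is governed by
`V⁰(x, -x)`. Compactness of `S` makes the estimate uniform; freezing the direction at `x₀` costs `K
s ‖x - x₀‖`. -/
lemma eventually_radial_quotient_le (hV : LocallyLipschitz V) {μ₁ μ₂ : ℝ}
    (hV2 : ∀ x : EuclideanSpace ℝ (Fin n), ∀ y ∈ Clarke.subdiff V x, μ₁ * V x + μ₂ ≤ y x)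
    {S : Set (EuclideanSpace ℝ (Fin n))} (hS : IsCompact S) {ε : ℝ} (hε : 0 < ε) :
    ∀ᶠ p : EuclideanSpace ℝ (Fin n) × ℝ in 𝓝 (0, 0), ∀ x ∈ S, 0 < p.2 →
      V (x + p.1) - V (x + p.1 + p.2 • x) ≤ p.2 * (-(μ₁ * V x + μ₂) + ε) := by
  refine hS.eventually_forall_of_forall_eventually fun x₀ _ => ?_
  have hlt := (dirDeriv_neg_le hV hV2 x₀).trans_lt
    (lt_add_of_pos_right _ (show 0 < ε / 3 by positivity))
  have h1 := Clarke.eventually_lt_of_dirDeriv_lt hV hlt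
  obtain ⟨A, hA, B, hB, hAB⟩ := eventually_prod_iff.1 h1
  rw [eventually_nhdsWithin_iff] at hB
  obtain ⟨K, U, hU, hK⟩ := hV x₀
  have hVc := hV.continuous
  have c1 : Tendsto (fun z : (EuclideanSpace ℝ (Fin n) × ℝ) × EuclideanSpace ℝ (Fin n) =>
      z.2 + z.1.1 + z.1.2 • x₀) (𝓝 ((0, 0), x₀)) (𝓝 x₀) :=
    Continuous.tendsto' (by fun_prop) _ _ (by simp)
  have c2 : Tendsto (fun z : (EuclideanSpace ℝ (Fin n) × ℝ) × EuclideanSpace ℝ (Fin n) =>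
      z.2 + z.1.1 + z.1.2 • z.2) (𝓝 ((0, 0), x₀)) (𝓝 x₀) :=
    Continuous.tendsto' (by fun_prop) _ _ (by simp)
  have c3 : Tendsto (fun z : (EuclideanSpace ℝ (Fin n) × ℝ) × EuclideanSpace ℝ (Fin n) =>
      z.1.2) (𝓝 ((0, 0), x₀)) (𝓝 0) := Continuous.tendsto' (by fun_prop) _ _ (by simp)
  have c4 : Tendsto (fun z : (EuclideanSpace ℝ (Fin n) × ℝ) × EuclideanSpace ℝ (Fin n) =>
      μ₁ * V z.2 + K * ‖z.2 - x₀‖) (𝓝 ((0, 0), x₀)) (𝓝 (μ₁ * V x₀)) :=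
    Continuous.tendsto' (by fun_prop) _ _ (by simp)
  -- The error is `ε / 3` from `V⁰` at `x₀` plus `ε / 2` from replacing `x₀` by `x`.
  filter_upwards [c1.eventually hA, c3.eventually hB, c1.eventually hU, c2.eventually hU,
    c4.eventually (gt_mem_nhds (lt_add_of_pos_right _ (half_pos hε)))] with z e1 e2 e3 e4 e5 hz
  have e6 := hAB e1 (e2 hz)
  simp only [smul_neg, add_neg_cancel_right] at e6
  rw [div_lt_iff₀ hz] at e6
  have e7 := (le_abs_self _).trans (hK.dist_le_mul _ e3 _ e4)
  rw [dist_comm, dist_eq_norm, add_sub_add_left_eq_sub, ← smul_sub, norm_smul, Real.norm_eq_abs,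
    abs_of_pos hz] at e7
  nlinarith [mul_lt_mul_of_pos_right e5 hz]

lemma dirDeriv_action_self_le (hV : LocallyLipschitz V) {μ₁ μ₂ : ℝ}
    (hV2 : ∀ x : EuclideanSpace ℝ (Fin n), ∀ y ∈ Clarke.subdiff V x, μ₁ * V x + μ₂ ≤ y x)
    (q : H1 T n) : Clarke.dirDeriv (action V) q q ≤
      ‖q.weakDeriv‖ ^ 2 - μ₁ * (∫ t in (0 : ℝ)..T, V (q.rep (t : AddCircle T))) - T * μ₂ := by
  have hVc := hV.continuous
  have h := dirDeriv_action_le hV (q := q) (v := q) (b := fun t => -(μ₁ * V (q.rep t) + μ₂))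
    (by fun_prop) fun ε hε => by
      have hr := eventually_radial_quotient_le hV hV2
        (isCompact_range q.rep.continuous) hε
      obtain ⟨δ, hδ, hr⟩ := Metric.eventually_nhds_iff.1 hr
      have hc : ContinuousAt (fun p : H1 T n => ‖H1.repL T n p - q.rep‖) q := by fun_prop
      have hN : ∀ᶠ p in 𝓝 q, ‖H1.repL T n p - q.rep‖ < δ :=
        hc.eventually (gt_mem_nhds (by simpa [H1.repL_apply] using hδ))
      have hs : ∀ᶠ s : ℝ in 𝓝[>] 0, s < δ := nhdsWithin_le_nhds (gt_mem_nhds hδ)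
      filter_upwards [tendsto_fst.eventually hN, tendsto_snd.eventually hs,
        Clarke.eventually_pos q] with p h1 h2 h3 t
      rw [H1.repL_apply] at h1
      -- The perturbation `p(t) - q(t)` is small uniformly in `t` by the Sobolev embedding.
      have := hr (y := (p.1.rep t - q.rep t, p.2)) (by
        rw [show ((0 : EuclideanSpace ℝ (Fin n)), (0 : ℝ)) = 0 from rfl, dist_zero_right,
          Prod.norm_def, max_lt_iff]
        exact ⟨((p.1.rep - q.rep).norm_coe_le_norm t).trans_lt h1, by
          rwa [Real.norm_eq_abs, abs_of_pos h3]⟩) (q.rep t) (mem_range_self t) h3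
      simpa using this
  refine h.trans (le_of_eq ?_)
  have i1 := (intervalIntegrable_comp_coe (hVc.comp q.rep.continuous) 0 T).const_mul μ₁
  simp only [Function.comp_apply] at i1
  rw [real_inner_self_eq_norm_sq, intervalIntegral.integral_neg,
    intervalIntegral.integral_add i1 (by simp), intervalIntegral.integral_const_mul,
    intervalIntegral.integral_const, smul_eq_mul]
  ring

end

end PeriodicSobolev

/-! ### A priori bounds, compactness and conclusion -/

namespace PeriodicSobolev

section

variable {T : ℝ} [hT : Fact (0 < T)] {n : ℕ} {V : EuclideanSpace ℝ (Fin n) → ℝ}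

/-- Compare `ξ q ≥ -‖ξ‖‖q‖` with the bound of `f⁰(q, q)` and substitute `∫ V(q) = ½‖q̇‖² - f(q)`. -/
lemma norm_weakDeriv_sq_le (hV : LocallyLipschitz V) {μ₁ μ₂ : ℝ}
    (hV2 : ∀ x : EuclideanSpace ℝ (Fin n), ∀ y ∈ Clarke.subdiff V x, μ₁ * V x + μ₂ ≤ y x)
    {q : H1 T n} {ξ : StrongDual ℝ (H1 T n)} (hξ : ξ ∈ Clarke.subdiff (action V) q) :
    (μ₁ / 2 - 1) * ‖q.weakDeriv‖ ^ 2 ≤ μ₁ * action V q - T * μ₂ + ‖ξ‖ * ‖q‖ := by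
  have h1 := (hξ q).trans (dirDeriv_action_self_le hV hV2 q)
  have h2 := (abs_le.1 (ξ.le_opNorm q)).1
  rw [action_eq]
  linarith

/-- Under the coercivity condition on `V`, bounds of the kinetic and of the potential energy bound
the norm of `H¹`. -/
lemma exists_norm_le (hV : Continuous V) {μ₁ a₁ a₂ : ℝ} (hμ₁ : 1 ≤ μ₁) (ha₁ : 0 < a₁)
    (hV3 : ∀ x : EuclideanSpace ℝ (Fin n), a₁ * ‖x‖ ^ μ₁ + a₂ ≤ V x) (A B : ℝ) :
    ∃ M, ∀ q : H1 T n, ‖q.weakDeriv‖ ≤ A →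
      ∫ t in (0 : ℝ)..T, V (q.rep (t : AddCircle T)) ≤ B → ‖q‖ ≤ M := by
  have hT0 := hT.out
  -- The oscillation of `q` is at most `(T + 1) / 2 * A`, so a larger `|q(0)|` would force `a₁|q(t)|
  -- + a₂ > B / T` for all `t`. The maximum with `1` allows `|q|` in place of `|q| ^ μ₁`.
  refine ⟨A + ((T + 1) / 2 * A + max 1 ((B / T - a₂) / a₁)), fun q hA hB => ?_⟩
  rw [H1.norm_def]
  refine add_le_add hA ?_
  rw [← sub_le_iff_le_add']
  by_contra! hm
  set m := ‖q.rep 0‖ - (T + 1) / 2 * A with hm'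
  obtain ⟨hm1, hm2⟩ := max_lt_iff.1 hm
  have hlow : ∀ t, a₁ * m + a₂ ≤ V (q.rep t) := fun t => by
    have h1 := H1.norm_rep_sub_rep_le q 0 t
    have h2 := norm_le_norm_add_norm_sub' (q.rep 0) (q.rep t)
    have h3 : (T + 1) / 2 * ‖q.weakDeriv‖ ≤ (T + 1) / 2 * A := by gcongr
    have h4 : m ≤ ‖q.rep t‖ := by linarith
    have h5 := Real.self_le_rpow_of_one_le (hm1.le.trans h4) hμ₁
    have h6 : a₁ * m ≤ a₁ * ‖q.rep t‖ ^ μ₁ := mul_le_mul_of_nonneg_left (h4.trans h5) ha₁.le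
    linarith [hV3 (q.rep t)]
  have h := intervalIntegral.integral_mono_on (f := fun _ => a₁ * m + a₂) hT0.le (by simp)
    (intervalIntegrable_comp_coe (hV.comp q.rep.continuous) 0 T) fun t _ => hlow t
  rw [intervalIntegral.integral_const, smul_eq_mul, sub_zero] at h
  have h2 := h.trans hB
  rw [div_lt_iff₀ ha₁, sub_lt_iff_lt_add, div_lt_iff₀ hT0] at hm2
  linarith

/-- Bounded almost critical sequences of the action are relatively compact. -/
lemma exists_subseq_tendsto (hV : LocallyLipschitz V) {q : ℕ → H1 T n}
    {ξ : ℕ → StrongDual ℝ (H1 T n)} (hξ : ∀ k, ξ k ∈ Clarke.subdiff (action V) (q k))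
    (hξ0 : Tendsto (fun k => ‖ξ k‖) atTop (𝓝 0)) {M : ℝ} (hM : ∀ k, ‖q k‖ ≤ M) :
    ∃ (a : H1 T n) (σ : ℕ → ℕ), StrictMono σ ∧ Tendsto (fun k => q (σ k)) atTop (𝓝 a) := by
  have hT0 := hT.out
  obtain ⟨u, σ, hσ, hu⟩ := H1.exists_subseq_tendsto_rep hM
  obtain ⟨K, hK⟩ := exists_lipschitzOnWith_closedBall hV (((T + 1) / 2 + 1) * M + 1)
  have hR : ∀ k, ‖(q k).rep‖ < ((T + 1) / 2 + 1) * M + 1 := fun k => by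
    have h1 := H1.norm_rep_le (q k)
    have h2 : ((T + 1) / 2 + 1) * ‖q k‖ ≤ ((T + 1) / 2 + 1) * M := by
      have := hM k
      gcongr
    linarith
  have half : ∀ j k, -(‖ξ k‖ * (2 * M)) ≤
      inner ℝ (q k).weakDeriv ((q j).weakDeriv - (q k).weakDeriv) +
        T * (K * ‖(q j).rep - (q k).rep‖) := fun j k => by
    have h1 := (hξ k (q j - q k)).trans (dirDeriv_action_le_of_lipschitzOnWith hV hK (hR k))
    rw [H1.weakDeriv_sub, H1.rep_sub] at h1
    refine le_trans ?_ h1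
    refine le_trans (neg_le_neg ?_) (abs_le.1 ((ξ k).le_opNorm (q j - q k))).1
    gcongr
    linarith [norm_sub_le (q j) (q k), hM j, hM k]
  -- In the sum of the two inequalities the inner products combine to `-‖q̇_j - q̇_k‖²`.
  have key : ∀ j k, dist (q j).weakDeriv (q k).weakDeriv ^ 2 ≤
      (‖ξ j‖ + ‖ξ k‖) * (2 * M) + 2 * (T * (K * dist (q j).rep (q k).rep)) := fun j k => by
    have h1 := half j k
    have h2 := half k j
    rw [norm_sub_rev] at h2
    rw [dist_eq_norm, dist_eq_norm, ← real_inner_self_eq_norm_sq]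
    rw [inner_sub_right] at h1 h2 ⊢
    rw [inner_sub_left, inner_sub_left]
    rw [real_inner_comm (q j).weakDeriv (q k).weakDeriv] at *
    linarith
  have hlim : Tendsto (fun p : ℕ × ℕ => (‖ξ (σ p.1)‖ + ‖ξ (σ p.2)‖) * (2 * M) +
      2 * (T * (K * dist (q (σ p.1)).rep (q (σ p.2)).rep))) atTop (𝓝 0) := by
    have e1 := hξ0.comp hσ.tendsto_atTop
    have e2 := cauchySeq_iff_tendsto_dist_atTop_0.1 hu.cauchySeq
    have e3 : Tendsto (fun p : ℕ × ℕ => ‖ξ (σ p.1)‖) atTop (𝓝 0) := by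
      rw [← prod_atTop_atTop_eq]; exact e1.comp tendsto_fst
    have e4 : Tendsto (fun p : ℕ × ℕ => ‖ξ (σ p.2)‖) atTop (𝓝 0) := by
      rw [← prod_atTop_atTop_eq]; exact e1.comp tendsto_snd
    simpa using ((e3.add e4).mul_const (2 * M)).add
      (((e2.const_mul (K : ℝ)).const_mul T).const_mul 2)
  have hcauchy : CauchySeq fun k => (q (σ k)).weakDeriv := by
    rw [cauchySeq_iff_tendsto_dist_atTop_0]
    have h := (squeeze_zero (fun _ => sq_nonneg _) (fun p : ℕ × ℕ => key (σ p.1) (σ p.2))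
      hlim).sqrt
    simpa only [Real.sqrt_sq dist_nonneg, Real.sqrt_zero] using h
  obtain ⟨g, hg⟩ := cauchySeq_tendsto_of_complete hcauchy
  obtain ⟨a, ha⟩ := H1.exists_tendsto hg
    (((continuous_eval_const (F := C(AddCircle T, EuclideanSpace ℝ (Fin n))) 0).tendsto u).comp hu)
  exact ⟨a, σ, hσ, ha⟩

end

end PeriodicSobolev

theorem lemma3p1 (n : ℕ) (T : ℝ) [Fact (0 < T)]
    (V : EuclideanSpace ℝ (Fin n) → ℝ) (hV1 : LocallyLipschitz V)
    (μ₁ μ₂ : ℝ) (hμ₁ : 2 < μ₁)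
    (hV2 : ∀ x : EuclideanSpace ℝ (Fin n), ∀ y ∈ Clarke.subdiff V x, μ₁ * V x + μ₂ ≤ y x)
    (a₁ a₂ : ℝ) (ha₁ : 0 < a₁)
    (hV3 : ∀ x : EuclideanSpace ℝ (Fin n), a₁ * ‖x‖ ^ μ₁ + a₂ ≤ V x) :
    Clarke.CPSC (PeriodicSobolev.action (T := T) V) := by
  have hlip := PeriodicSobolev.locallyLipschitz_action (T := T) hV1
  refine fun c => ⟨hlip, fun q hf hm => ?_⟩
  have hpos : ∀ k, 0 < 1 + ‖q k‖ := fun k => by positivity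
  -- The tolerance is divided by the Cerami weight, so the weighted excess is `1 / (k + 1)`.
  choose ξ hξ hξm using fun k => Clarke.exists_norm_lt_minNorm_add hlip (q k)
    (ε := 1 / ((k : ℝ) + 1) / (1 + ‖q k‖)) (div_pos Nat.one_div_pos_of_nat (hpos k))
  have hξ1 : Tendsto (fun k => (1 + ‖q k‖) * ‖ξ k‖) atTop (𝓝 0) := by
    refine squeeze_zero (fun k => mul_nonneg (hpos k).le (norm_nonneg _)) (fun k => ?_)
      (add_zero (0 : ℝ) ▸ hm.add tendsto_one_div_add_atTop_nhds_zero_nat)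
    have := mul_le_mul_of_nonneg_left (hξm k).le (hpos k).le
    rwa [mul_add, mul_div_cancel₀ _ (hpos k).ne'] at this
  have hξ0 : Tendsto (fun k => ‖ξ k‖) atTop (𝓝 0) :=
    squeeze_zero (fun _ => norm_nonneg _)
      (fun k => by nlinarith [norm_nonneg (q k), norm_nonneg (ξ k)]) hξ1
  obtain ⟨D, hD⟩ := hξ1.bddAbove_range
  obtain ⟨F, hF⟩ := hf.bddAbove_range
  obtain ⟨F', hF'⟩ := hf.bddBelow_range
  have hκ : 0 < μ₁ / 2 - 1 := by linarith
  -- Here `D` bounds `‖ξ_k‖‖q_k‖`, thanks to the weight.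
  set A := (μ₁ * F - T * μ₂ + D) / (μ₁ / 2 - 1) with hA
  have hsq : ∀ k, ‖(q k).weakDeriv‖ ^ 2 ≤ A := fun k => by
    have h1 := PeriodicSobolev.norm_weakDeriv_sq_le hV1 hV2 (hξ k)
    have h2 : (1 + ‖q k‖) * ‖ξ k‖ ≤ D := hD (mem_range_self k)
    have h3 : PeriodicSobolev.action V (q k) ≤ F := hF (mem_range_self k)
    rw [hA, le_div_iff₀ hκ]
    nlinarith [norm_nonneg (ξ k)]
  obtain ⟨M, hM⟩ := PeriodicSobolev.exists_norm_le (T := T) hV1.continuous (by linarith) ha₁ hV3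
    -- `∫ V(q_k) = ½‖q̇_k‖² - f(q_k) ≤ A / 2 - F'`.
    (√A) (A / 2 - F')
  refine PeriodicSobolev.exists_subseq_tendsto hV1 hξ hξ0 fun k =>
    hM (q k) (Real.le_sqrt_of_sq_le (hsq k)) ?_
  have h1 : F' ≤ PeriodicSobolev.action V (q k) := hF' (mem_range_self k)
  rw [PeriodicSobolev.action_eq] at h1
  linarith [hsq k]
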